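/- Let $E$ be a finite-dimensional real vector space of dimension $n$ and $\Lambda\subset E$ a (full-rank) lattice. A lattice polytope is the convex hull $P$ of a finite subset of $\Lambda$ that affinely spans $E$. Let $\mathrm{Isom}(P)$ be the group of affine bijections $g$ of $E$ with $g(\Lambda)=\Lambda$ and $g(P)=P$. A complete flag of $P$ is a chain of faces $F_0\subset F_1\subset\dots\subset F_n$ with $\dim F_i=i$; $P$ is regular if $\mathrm{Isom}(P)$ acts transitively on the complete flags of $P$, and centered if the barycenter of its vertices is $0$. Let $\Phi(P)\subset\Lambda$ be the set of the vectors $\pm u_a$, where $a=[s_1,s_2]$ runs over the edges of $P$ and $\pm u_a$ are the two generators of the group $\mathbb R(s_2-s_1)\cap\Lambda$. **Proposition.** Let $P$ be a centered regular lattice polytope. Then: 1. $\Phi(P)$ is a reduced (crystallographic) root system in $E$. 2. The Weyl group $W$ of $\Phi(P)$ maps the set of vertices of $P$ to itself and acts transitively on it. 3. Every maximal cone of the dual fan of $P$ is a union of closed Weyl chambers of $\Phi(P)$. Here the dual fan consists of the cones $\{\varphi\in E^*: \varphi(v)\le\varphi(x)\ \text{for all } v\in F,\ x\in P\}$, where $F$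 runs over the non-empty faces of $P$ (including $P$ itself), and the closed Weyl chambers are the closures in $E^*$ of the connected components of $\{\varphi\in E^*:\varphi(\alpha)\neq 0\ \text{for all } \alpha\in\Phi(P)\}$. -/

import Mathlib

namespace LatticePolytope

variable {E : Type*} [NormedAddCommGroup E] [NormedSpace ℝ E]

/-- A (non-degenerate) lattice polytope: the convex hull of a finite set of points of `Λ`
which affinely spans the ambient space. -/
def IsLatticePolytope (Λ : Submodule ℤ E) (P : Set E) : Prop :=
  (∃ S : Finset E, (S : Set E) ⊆ (Λ : Set E) ∧ P = convexHull ℝ (S : Set E)) ∧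
    affineSpan ℝ P = ⊤

/-- The vertices of `P`. -/
def vertices (P : Set E) : Set E := P.extremePoints ℝ

/-- The non-empty faces of `P` (with `P` itself): the subsets of `P` on which some linear form
attains its maximum over `P`. -/
def IsFace (P F : Set E) : Prop := F.Nonempty ∧ IsExposed ℝ P F

/-- The dimension of a set: the dimension of the direction of its affine span. -/
noncomputable def faceDim (F : Set E) : ℕ := Module.finrank ℝ (vectorSpan ℝ F)

/-- A complete flag of `P`: a chain of faces `F 0 ⊆ F 1 ⊆ ... ⊆ F n` with `F i` of
dimension `i`, where `n` is the dimension of the ambient space. -/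
def IsCompleteFlag (P : Set E) (F : Fin (Module.finrank ℝ E + 1) → Set E) : Prop :=
  (∀ i, IsFace P (F i) ∧ faceDim (F i) = (i : ℕ)) ∧ Monotone F

/-- The group of affine bijections of the ambient space mapping the lattice `Λ` onto itself
and `P` onto itself. -/
def Isom (Λ : Submodule ℤ E) (P : Set E) : Subgroup (E ≃ᵃ[ℝ] E) where
  carrier := {g | g '' (Λ : Set E) = (Λ : Set E) ∧ g '' P = P}
  one_mem' := by
    constructor <;> simp
  mul_mem' := by
    rintro a b ⟨ha, ha'⟩ ⟨hb, hb'⟩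
    refine ⟨?_, ?_⟩
    · rw [AffineEquiv.coe_mul, Set.image_comp, hb, ha]
    · rw [AffineEquiv.coe_mul, Set.image_comp, hb', ha']
  inv_mem' := by
    have key : ∀ (g : E ≃ᵃ[ℝ] E) (A : Set E), g '' A = A → (g⁻¹ : E ≃ᵃ[ℝ] E) '' A = A := by
      intro g A h
      have h1 : (g⁻¹ : E ≃ᵃ[ℝ] E) '' (g '' A) = A := by
        rw [← Set.image_comp, ← AffineEquiv.coe_mul, inv_mul_cancel]
        simp
      rwa [h] at h1
    rintro g ⟨h, h'⟩
    exact ⟨key g _ h, key g _ h'⟩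

/-- A regular lattice polytope: `Isom Λ P` is transitive on the complete flags of `P`. -/
def IsRegular (Λ : Submodule ℤ E) (P : Set E) : Prop :=
  IsLatticePolytope Λ P ∧
    ∀ F G, IsCompleteFlag P F → IsCompleteFlag P G →
      ∃ g ∈ Isom Λ P, ∀ i, g '' F i = G i

/-- The barycenter of the vertices of `P`. -/
noncomputable def barycenter (P : Set E) : E :=
  ((vertices P).ncard : ℝ)⁻¹ • ∑ᶠ v ∈ vertices P, v

/-- `P` is centered if its barycenter is the origin. -/
def IsCentered (P : Set E) : Prop := barycenter P = 0

/-- The set `Φ(P)`: for every edge `[s₁, s₂]` of `P`, the generators of the group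
`ℝ (s₂ - s₁) ∩ Λ`. -/
def edgeRoots (Λ : Submodule ℤ E) (P : Set E) : Set E :=
  {u | ∃ s₁ s₂ : E, s₁ ≠ s₂ ∧ IsFace P (segment ℝ s₁ s₂) ∧
    Submodule.span ℤ {u} = (Submodule.span ℝ {s₂ - s₁}).restrictScalars ℤ ⊓ Λ}

/-- `R` is a presentation of the set `Φ` as a reduced (crystallographic) root system
of the vector space `E`. (The coroots, hence the reflections, are determined by `Φ`.) -/
structure IsReducedRootSystemOn (Φ : Set E) (R : RootPairing Φ ℝ E (Module.Dual ℝ E)) : Prop where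
  finite : Φ.Finite
  root_eq : ∀ α : Φ, R.root α = (α : E)
  isRootSystem : R.IsRootSystem
  isCrystallographic : R.IsCrystallographic
  isReduced : R.IsReduced

/-- The cone of the dual fan associated to a face `F` of `P`: the linear forms whose minimum
over `P` is attained at every point of `F`. -/
def dualCone (P F : Set E) : Set (StrongDual ℝ E) :=
  {φ | ∀ v ∈ F, ∀ x ∈ P, φ v ≤ φ x}

/-- The dual fan of `P`. -/
def dualFan (P : Set E) : Set (Set (StrongDual ℝ E)) :=
  {σ | ∃ F, IsFace P F ∧ σ = dualCone P F}

/-- The complement in the dual space of the hyperplanes orthogonal to the elements of `Φ`. -/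
def regularForms (Φ : Set E) : Set (StrongDual ℝ E) := {φ | ∀ α ∈ Φ, φ α ≠ 0}

/-- The (open) Weyl chambers of `Φ` in the dual space: the connected components of the
complement of the hyperplanes orthogonal to the elements of `Φ`. -/
def weylChambers (Φ : Set E) : Set (Set (StrongDual ℝ E)) :=
  {C | ∃ φ ∈ regularForms Φ, C = connectedComponentIn (regularForms Φ) φ}

end LatticePolytope

/-! The reflections come from regularity. Given an edge [s₁, s₂], choose a chain of faces starting
with it, one in each dimension from 1 to n. Adding s₁ or s₂ gives two complete flags that differ
only in their vertex, and some g in `Isom Λ P` carries the first to the second. It fixes the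
barycenter 0 of P, so it is linear, and it fixes the barycenters of all faces of the chain. The
differences of consecutive barycenters, together with s₂ - s₁, span E; since g swaps s₁ and s₂, it
is a reflection (`vectorSpan_le_fixed_sup`, `IsRegular.exists_reflection`). These reflections
preserve Λ and P, hence Φ(P), and the primitivity of the roots in Λ makes the system
crystallographic and reduced.

The rest is linear programming: at a vertex v where a linear form is not minimal, some edge
decreases it (`exists_edge_lt`). Hence a form that kills every root is constant on P, so the roots
span E. Descending along edges, where each step is a reflection, joins any vertex to any other.
Finally, v minimises φ exactly when φ is non-negative on the edges leaving v; edges are multiples of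
roots, so these signs are constant on a Weyl chamber. -/

namespace LatticePolytope

open Module Filter

/-! ### Faces, vertices and edges of polytopes. -/

section Polytope

variable {E : Type*} [NormedAddCommGroup E] [NormedSpace ℝ E] {P F : Set E}

theorem isCompact_of_convexHull (hP : ∃ S : Finset E, P = convexHull ℝ (S : Set E)) :
    IsCompact P := by
  obtain ⟨S, rfl⟩ := hP
  exact S.finite_toSet.isCompact_convexHull ℝ

theorem convex_of_convexHull (hP : ∃ S : Finset E, P = convexHull ℝ (S : Set E)) :
    Convex ℝ P := by
  obtain ⟨S, rfl⟩ := hP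
  exact convex_convexHull ℝ _

theorem finite_vertices (hP : ∃ S : Finset E, P = convexHull ℝ (S : Set E)) :
    (vertices P).Finite := by
  obtain ⟨S, rfl⟩ := hP
  exact S.finite_toSet.subset extremePoints_convexHull_subset

theorem IsFace.subset (hF : IsFace P F) : F ⊆ P := hF.2.subset

theorem IsFace.vertices_eq (hF : IsFace P F) : vertices F = F ∩ vertices P :=
  hF.2.isExtreme.extremePoints_eq

theorem IsFace.isCompact (hP : ∃ S : Finset E, P = convexHull ℝ (S : Set E)) (hF : IsFace P F) :
    IsCompact F := hF.2.isCompact (isCompact_of_convexHull hP)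

theorem IsFace.convex (hP : ∃ S : Finset E, P = convexHull ℝ (S : Set E)) (hF : IsFace P F) :
    Convex ℝ F := hF.2.convex (convex_of_convexHull hP)

/-- A face is the convex hull of the vertices of `P` that it contains. -/
theorem IsFace.convexHull_inter_vertices (hP : ∃ S : Finset E, P = convexHull ℝ (S : Set E))
    (hF : IsFace P F) : convexHull ℝ (F ∩ vertices P) = F := by
  have h := closure_convexHull_extremePoints (hF.isCompact hP) (hF.convex hP)
  have hfin : (F ∩ vertices P).Finite := (finite_vertices hP).inter_of_right F
  rwa [show F.extremePoints ℝ = F ∩ vertices P from hF.vertices_eq,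
    (hfin.isClosed_convexHull ℝ).closure_eq] at h

theorem isFace_self (hP : P.Nonempty) : IsFace P P := ⟨hP, IsExposed.refl P⟩

theorem convexHull_vertices (hP : ∃ S : Finset E, P = convexHull ℝ (S : Set E)) :
    convexHull ℝ (vertices P) = P := by
  have h := closure_convexHull_extremePoints (isCompact_of_convexHull hP) (convex_of_convexHull hP)
  change closure (convexHull ℝ (vertices P)) = P at h
  rwa [((finite_vertices hP).isClosed_convexHull ℝ).closure_eq] at h

theorem IsFace.exists_vertex (hP : ∃ S : Finset E, P = convexHull ℝ (S : Set E))
    (hF : IsFace P F) : ∃ v ∈ F, v ∈ vertices P := by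
  have h := hF.1
  rw [← hF.convexHull_inter_vertices hP, convexHull_nonempty_iff] at h
  exact h

theorem exists_vertex_lt (hP : ∃ S : Finset E, P = convexHull ℝ (S : Set E)) (φ : Dual ℝ E)
    {x : E} (hx : x ∈ P) {c : ℝ} (h : φ x < c) : ∃ v ∈ vertices P, φ v < c := by
  by_contra! H
  have : P ⊆ {y | c ≤ φ y} := by
    rw [← convexHull_vertices hP]
    exact convexHull_min H (convex_halfSpace_ge φ.isLinear c)
  exact absurd (this hx) (not_le.2 h)

theorem forall_le_of_vertices (hP : ∃ S : Finset E, P = convexHull ℝ (S : Set E)) (φ : Dual ℝ E)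
    {c : ℝ} (h : ∀ v ∈ vertices P, c ≤ φ v) {x : E} (hx : x ∈ P) : c ≤ φ x := by
  by_contra! H
  obtain ⟨v, hv, hlt⟩ := exists_vertex_lt hP φ hx H
  exact absurd (h v hv) (not_le.2 hlt)

/-- Exposed faces are cut out by maxima, the dual fan by minima; the sign is changed here once and
for all. -/
theorem IsFace.exists_dual (hF : IsFace P F) :
    ∃ φ : Dual ℝ E, ∃ v ∈ F, (∀ x ∈ P, φ v ≤ φ x) ∧ F = {x ∈ P | φ x = φ v} := by
  obtain ⟨l, hl⟩ := hF.2 hF.1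
  obtain ⟨v, hv⟩ := hF.1
  have hv' := hv
  rw [hl] at hv'
  refine ⟨-(l : E →ₗ[ℝ] ℝ), v, hv, fun x hx => by simpa using hv'.2 x hx, ?_⟩
  rw [hl]
  ext x
  simp only [Set.mem_ofPred_eq, LinearMap.neg_apply, neg_inj, ContinuousLinearMap.coe_coe]
  refine and_congr_right fun hx => ⟨fun h => le_antisymm (hv'.2 x hx) (h v hv'.1), fun h => ?_⟩
  rw [h]
  exact hv'.2

theorem isFace_of_forall_le [FiniteDimensional ℝ E] (φ : Dual ℝ E) {v : E} (hv : v ∈ P)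
    (h : ∀ x ∈ P, φ v ≤ φ x) : IsFace P {x ∈ P | φ x = φ v} := by
  refine ⟨⟨v, hv, rfl⟩, fun _ => ⟨LinearMap.toContinuousLinearMap (-φ), ?_⟩⟩
  ext x
  simp only [Set.mem_ofPred_eq, LinearMap.coe_toContinuousLinearMap', LinearMap.neg_apply,
    neg_le_neg_iff]
  refine and_congr_right fun hx => ⟨fun hxv y hy => hxv ▸ h y hy, fun hx' => ?_⟩
  exact le_antisymm (hx' v hv) (h x hx)

/-- Vertices of polytopes are exposed. -/
theorem exists_dual_lt [FiniteDimensional ℝ E]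
    (hP : ∃ S : Finset E, P = convexHull ℝ (S : Set E)) {v : E}
    (hv : v ∈ vertices P) : ∃ φ : Dual ℝ E, ∀ x ∈ P, x ≠ v → φ v < φ x := by
  have hfin := (finite_vertices hP).subset (Set.sdiff_subset (t := {v}))
  -- Since v is extreme, P minus v is still convex, so it contains the hull of the other vertices.
  have hnot : v ∉ convexHull ℝ (vertices P \ {v}) := fun h => by
    have h1 := ((convex_of_convexHull hP).mem_extremePoints_iff_convex_sdiff.1 hv).2
    have h2 : convexHull ℝ (vertices P \ {v}) ⊆ P \ {v} :=
      convexHull_min (Set.sdiff_subset_sdiff_left extremePoints_subset) h1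
    exact (h2 h).2 rfl
  obtain ⟨f, u, hu, hf⟩ := geometric_hahn_banach_point_closed (convex_convexHull ℝ _)
    (hfin.isClosed_convexHull ℝ) hnot
  have hlt : ∀ w ∈ vertices P, w ≠ v → f v < f w := fun w hw hne =>
    hu.trans (hf w (subset_convexHull ℝ _ ⟨hw, hne⟩))
  have hle : ∀ x ∈ P, (f : E →ₗ[ℝ] ℝ) v ≤ (f : E →ₗ[ℝ] ℝ) x := fun x hx =>
    forall_le_of_vertices hP (f : E →ₗ[ℝ] ℝ) (fun w hw => by
      rcases eq_or_ne w v with rfl | hne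
      exacts [le_rfl, (hlt w hw hne).le]) hx
  have hface := isFace_of_forall_le (f : E →ₗ[ℝ] ℝ) hv.1 hle
  have hone : {x ∈ P | (f : E →ₗ[ℝ] ℝ) x = (f : E →ₗ[ℝ] ℝ) v} ⊆ {v} := by
    rw [← hface.convexHull_inter_vertices hP]
    refine convexHull_min (fun w hw => ?_) (convex_singleton v)
    by_contra hne
    exact (hlt w hw.2 hne).ne' hw.1.2
  refine ⟨f, fun x hx hne => lt_of_le_of_ne (hle x hx) fun h => hne (hone ⟨hx, h.symm⟩)⟩

theorem isFace_singleton [FiniteDimensional ℝ E]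
    (hP : ∃ S : Finset E, P = convexHull ℝ (S : Set E)) {v : E}
    (hv : v ∈ vertices P) : IsFace P {v} := by
  obtain ⟨φ, hφ⟩ := exists_dual_lt hP hv
  have hle : ∀ x ∈ P, φ v ≤ φ x := fun x hx => by
    rcases eq_or_ne x v with rfl | hne
    exacts [le_rfl, (hφ x hx hne).le]
  convert isFace_of_forall_le φ hv.1 hle
  ext x
  refine ⟨?_, fun h => by_contra fun hne => (hφ x h.1 hne).ne' h.2⟩
  rintro rfl
  exact ⟨hv.1, rfl⟩

theorem mem_vertices_of_isFace_singleton {v : E} (hv : IsFace P {v}) : v ∈ vertices P :=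
  isExtreme_singleton.1 hv.2.isExtreme

/-- A linear form can be perturbed so that it has a unique minimum on a given finite set. -/
theorem exists_dual_unique_min {M : Type*} [AddCommGroup M] [Module ℝ M] {T : Set M}
    (hT : T.Finite) (hne : T.Nonempty) (φ : Dual ℝ M) :
    ∃ d ∈ T, (∀ t ∈ T, φ d ≤ φ t) ∧ ∃ ψ : Dual ℝ M, ∀ t ∈ T, t ≠ d → ψ d < ψ t := by
  classical
  have : Finite T := hT
  -- θ separates the points of T and breaks ties: d is the θ-smallest minimiser of φ, and ψ is φ +
  -- εθ for a small ε > 0.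
  obtain ⟨θ, hθ⟩ := Module.exists_dual_forall_apply_ne_zero (K := ℝ)
    (v := fun p : {p : T × T // p.1 ≠ p.2} => ((p.1.1 : M) - p.1.2))
    (fun p => sub_ne_zero.2 fun h => p.2 (Subtype.ext h))
  have hinj : ∀ s ∈ T, ∀ t ∈ T, s ≠ t → θ s ≠ θ t := fun s hs t ht hst h =>
    hθ ⟨(⟨s, hs⟩, ⟨t, ht⟩), fun h => hst (congrArg Subtype.val h)⟩ (by simp [h])
  obtain ⟨m, hm, hmin⟩ := hT.exists_minimalFor φ T hne
  have hmin' : ∀ t ∈ T, φ m ≤ φ t := fun t ht => by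
    by_contra! h
    exact absurd (hmin ht h.le) (not_le.2 h)
  have hT' : {t ∈ T | φ t = φ m}.Finite := hT.subset (Set.sep_subset _ _)
  obtain ⟨d, hd, hdmin⟩ := hT'.exists_minimalFor θ _ ⟨m, hm, rfl⟩
  have key : ∀ t ∈ T, t ≠ d →
      ∀ᶠ ε : ℝ in nhdsWithin 0 (Set.Ioi 0), φ d + ε * θ d < φ t + ε * θ t := by
    intro t ht htd
    rcases (hd.2 ▸ hmin' t ht : φ d ≤ φ t).lt_or_eq with h | h
    · have h1 : Filter.Tendsto (fun ε : ℝ => φ d + ε * θ d) (nhds 0) (nhds (φ d)) :=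
        Continuous.tendsto' (by fun_prop) _ _ (by simp)
      have h2 : Filter.Tendsto (fun ε : ℝ => φ t + ε * θ t) (nhds 0) (nhds (φ t)) :=
        Continuous.tendsto' (by fun_prop) _ _ (by simp)
      exact (h1.eventually_lt h2 h).filter_mono nhdsWithin_le_nhds
    · have hlt : θ d < θ t := by
        refine lt_of_le_of_ne ?_ (hinj d hd.1 t ht htd.symm)
        by_contra! h'
        exact absurd (hdmin ⟨ht, h ▸ hd.2⟩ h'.le) (not_le.2 h')
      filter_upwards [self_mem_nhdsWithin] with ε hε
      rw [h]
      have := mul_lt_mul_of_pos_left hlt (Set.mem_Ioi.1 hε)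
      linarith
  have key' : ∀ᶠ ε : ℝ in nhdsWithin 0 (Set.Ioi 0), ∀ t ∈ T, t ≠ d →
      φ d + ε * θ d < φ t + ε * θ t := by
    refine (Filter.eventually_all_finite hT).2 fun t ht => ?_
    by_cases h : t = d
    · simp [h]
    · filter_upwards [key t ht h] with ε hε _ using hε
  obtain ⟨ε, hε⟩ := key'.exists
  exact ⟨d, hd.1, fun t ht => hd.2 ▸ hmin' t ht, φ + ε • θ, fun t ht htd => by
    simpa using hε t ht htd⟩

theorem vectorSpan_eq_span_sub {F : Set E} {v : E} (hv : v ∈ F) :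
    vectorSpan ℝ F = Submodule.span ℝ ((fun x => x - v) '' F) := by
  rw [vectorSpan_eq_span_vsub_set_right ℝ hv]
  rfl

theorem sub_mem_vectorSpan {F : Set E} {v w : E} (hv : v ∈ F) (hw : w ∈ F) :
    v - w ∈ vectorSpan ℝ F := vsub_mem_vectorSpan ℝ hv hw

theorem vectorSpan_le_iff {F : Set E} {v : E} (hv : v ∈ F) {V : Submodule ℝ E} :
    vectorSpan ℝ F ≤ V ↔ ∀ x ∈ F, x - v ∈ V := by
  rw [vectorSpan_eq_span_sub hv, Submodule.span_le]
  simp [Set.subset_def]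

theorem vectorSpan_convexHull (F : Set E) : vectorSpan ℝ (convexHull ℝ F) = vectorSpan ℝ F := by
  rw [← direction_affineSpan, affineSpan_convexHull, direction_affineSpan]

/-- Let `F` be a face of `P`, and `φ` a linear form that is constant on `F` and takes smaller values
on `P`. Then it takes smaller values on some face containing `F` whose dimension is one more. -/
theorem IsFace.exists_succ [FiniteDimensional ℝ E]
    (hP : ∃ S : Finset E, P = convexHull ℝ (S : Set E)) (hF : IsFace P F) (φ : Dual ℝ E) {c : ℝ}
    (hφF : ∀ x ∈ F, φ x = c) (hφ : ∃ x ∈ P, φ x < c) :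
    ∃ F', IsFace P F' ∧ F ⊆ F' ∧ faceDim F' = faceDim F + 1 ∧ ∃ x ∈ F', φ x < c := by
  obtain ⟨φ₀, v, hv, hmin, hFeq⟩ := hF.exists_dual
  set V := vectorSpan ℝ F with hV
  have hmemF : ∀ x ∈ P, φ₀ x = φ₀ v → x ∈ F := fun x hx h => by rw [hFeq]; exact ⟨hx, h⟩
  have hφ₀F : ∀ x ∈ F, φ₀ x = φ₀ v := fun x hx => by rw [hFeq] at hx; exact hx.2
  have hφ₀V : V ≤ LinearMap.ker φ₀ := (vectorSpan_le_iff hv).2 fun x hx => by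
    simp [hφ₀F x hx]
  have hφV : V ≤ LinearMap.ker φ := (vectorSpan_le_iff hv).2 fun x hx => by
    simp [hφF x hx, hφF v hv]
  set S := vertices P \ F
  have hSfin : S.Finite := (finite_vertices hP).subset Set.sdiff_subset
  have hpos : ∀ s ∈ P, s ∉ F → 0 < φ₀ s - φ₀ v := fun s hs hsF =>
    sub_pos.2 (lt_of_le_of_ne (hmin s hs) fun h => hsF (hmemF s hs h.symm))
  -- The face figure: each vertex outside F is projected along V and rescaled to height 1 for φ₀.
  -- Vertices of this figure correspond to the faces of dimension one more that contain F, and φ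
  -- descends to it.
  let d : E → E ⧸ V := fun s => V.mkQ ((φ₀ s - φ₀ v)⁻¹ • (s - v))
  obtain ⟨x₀, hx₀, hx₀c⟩ := hφ
  obtain ⟨s₁, hs₁, hs₁c⟩ := exists_vertex_lt hP φ hx₀ hx₀c
  have hs₁S : s₁ ∈ S := ⟨hs₁, fun h => hs₁c.ne (hφF s₁ h)⟩
  let φq : Dual ℝ (E ⧸ V) := V.liftQ φ hφV
  have hφq : ∀ s, φq (d s) = (φ₀ s - φ₀ v)⁻¹ * (φ s - c) := fun s => by
    simp [φq, d, hφF v hv]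
  obtain ⟨_, ⟨s₀, hs₀, rfl⟩, hd₁, ψ, hψ⟩ :=
    exists_dual_unique_min (hSfin.image d) ⟨_, s₁, hs₁S, rfl⟩ φq
  have hs₀c : φ s₀ < c := by
    have h1 := hd₁ _ ⟨s₁, hs₁S, rfl⟩
    rw [hφq, hφq] at h1
    have h2 : (φ₀ s₁ - φ₀ v)⁻¹ * (φ s₁ - c) < 0 :=
      mul_neg_of_pos_of_neg (inv_pos.2 (hpos s₁ hs₁.1 hs₁S.2)) (by linarith)
    have h3 := inv_pos.2 (hpos s₀ hs₀.1.1 hs₀.2)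
    by_contra! h
    have := mul_nonneg h3.le (sub_nonneg.2 h)
    linarith
  -- χ supports the required face: χ s - χ v is a positive multiple of ψ (d s) - ψ (d s₀), so among
  -- the vertices outside F it vanishes exactly on those lying over d s₀.
  let χ : Dual ℝ E := ψ ∘ₗ V.mkQ - ψ (d s₀) • φ₀
  have hψd : ∀ s ∈ P, s ∉ F → χ s - χ v = (φ₀ s - φ₀ v) * (ψ (d s) - ψ (d s₀)) := by
    intro s hs hsF
    have h := (hpos s hs hsF).ne'
    have h1 : ψ (V.mkQ s) - ψ (V.mkQ v) = (φ₀ s - φ₀ v) * ψ (d s) := by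
      simp only [d, map_smul, map_sub, smul_eq_mul]
      field_simp
    simp only [χ, LinearMap.sub_apply, LinearMap.comp_apply, LinearMap.smul_apply, smul_eq_mul]
    linear_combination h1
  have hχF : ∀ x ∈ F, χ x = χ v := by
    intro x hx
    have h1 : V.mkQ x = V.mkQ v := by
      rw [← sub_eq_zero, ← map_sub, ← LinearMap.mem_ker, Submodule.ker_mkQ]
      exact sub_mem_vectorSpan hx hv
    simp only [χ, LinearMap.sub_apply, LinearMap.comp_apply, LinearMap.smul_apply, h1, hφ₀F x hx]
  have hχle : ∀ s ∈ vertices P, χ v ≤ χ s := by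
    intro s hs
    by_cases hsF : s ∈ F
    · exact (hχF s hsF).ge
    · have h1 : ψ (d s₀) ≤ ψ (d s) := by
        rcases eq_or_ne (d s) (d s₀) with h | h
        exacts [h ▸ le_rfl, (hψ _ ⟨s, ⟨hs, hsF⟩, rfl⟩ h).le]
      have := hψd s hs.1 hsF
      have := mul_nonneg (hpos s hs.1 hsF).le (sub_nonneg.2 h1)
      linarith
  have hvP := hF.subset hv
  set F' := {x ∈ P | χ x = χ v} with hF'
  have hface : IsFace P F' :=
    isFace_of_forall_le χ hvP fun x hx => forall_le_of_vertices hP χ hχle hx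
  have hsub : F ⊆ F' := fun x hx => ⟨hF.subset hx, hχF x hx⟩
  have hs₀F' : s₀ ∈ F' := ⟨hs₀.1.1, by
    have := hψd s₀ hs₀.1.1 hs₀.2
    rw [sub_self, mul_zero, sub_eq_zero] at this
    exact this⟩
  have hspan : vectorSpan ℝ F' = V ⊔ Submodule.span ℝ {s₀ - v} := by
    apply le_antisymm
    · suffices h : ∀ s ∈ F', s ∈ vertices P → s - v ∈ V ⊔ Submodule.span ℝ {s₀ - v} by
        refine (vectorSpan_le_iff (hsub hv)).2 fun x hx => ?_
        have hc : Convex ℝ {y | y - v ∈ V ⊔ Submodule.span ℝ {s₀ - v}} := by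
          have := (Submodule.convex (V ⊔ Submodule.span ℝ {s₀ - v})).translate_preimage_left (-v)
          simpa [Set.preimage, sub_eq_add_neg] using this
        rw [← hface.convexHull_inter_vertices hP] at hx
        exact convexHull_min (fun s hs => h s hs.1 hs.2) hc hx
      intro s hs hsv
      by_cases hsF : s ∈ F
      · exact Submodule.mem_sup_left (sub_mem_vectorSpan hsF hv)
      · have hds : d s = d s₀ := by
          by_contra hne
          have h1 := hψ _ ⟨s, ⟨hsv, hsF⟩, rfl⟩ hne
          have h2 := hψd s hs.1 hsF
          have h3 := mul_pos (hpos s hs.1 hsF) (sub_pos.2 h1)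
          have h4 := hs.2
          linarith
        have h1 : (φ₀ s - φ₀ v)⁻¹ • (s - v) - (φ₀ s₀ - φ₀ v)⁻¹ • (s₀ - v) ∈ V := by
          rw [← Submodule.ker_mkQ V, LinearMap.mem_ker, map_sub, sub_eq_zero]
          exact hds
        have h2 : s - v = (φ₀ s - φ₀ v) • ((φ₀ s - φ₀ v)⁻¹ • (s - v) -
              (φ₀ s₀ - φ₀ v)⁻¹ • (s₀ - v)) +
            ((φ₀ s - φ₀ v) * (φ₀ s₀ - φ₀ v)⁻¹) • (s₀ - v) := by
          rw [smul_sub, smul_smul, mul_inv_cancel₀ (hpos s hs.1 hsF).ne', one_smul, smul_smul,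
            sub_add_cancel]
        rw [h2]
        exact add_mem (Submodule.mem_sup_left (V.smul_mem _ h1))
          (Submodule.mem_sup_right (Submodule.smul_mem _ _ (Submodule.mem_span_singleton_self _)))
    · refine sup_le (vectorSpan_mono ℝ hsub) ?_
      rw [Submodule.span_singleton_le_iff_mem]
      exact sub_mem_vectorSpan hs₀F' (hsub hv)
  refine ⟨F', hface, hsub, ?_, s₀, hs₀F', hs₀c⟩
  have hnot : s₀ - v ∉ V := fun h => by
    have := hφ₀V h
    rw [LinearMap.mem_ker, map_sub] at this
    exact (hpos s₀ hs₀.1.1 hs₀.2).ne' this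
  rw [faceDim, hspan]
  exact Submodule.finrank_sup_span_singleton hnot

theorem faceDim_singleton (v : E) : faceDim ({v} : Set E) = 0 := by
  simp [faceDim]

/-- At a vertex of `P` that does not minimise `φ`, there is an edge along which `φ` decreases. -/
theorem exists_edge_lt [FiniteDimensional ℝ E]
    (hP : ∃ S : Finset E, P = convexHull ℝ (S : Set E)) {v : E} (hv : v ∈ vertices P)
    (φ : Dual ℝ E) (hφ : ∃ x ∈ P, φ x < φ v) : ∃ w, IsFace P (segment ℝ v w) ∧ φ w < φ v := by
  obtain ⟨F, hF, hvF, hdim, x, hx, hxv⟩ :=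
    (isFace_singleton hP hv).exists_succ hP φ (by simp) hφ
  rw [faceDim_singleton, zero_add] at hdim
  have hvF : v ∈ F := hvF rfl
  obtain ⟨w, hwF, hw⟩ := (hF.isCompact hP).exists_isMinOn ⟨v, hvF⟩
    (φ.continuous_of_finiteDimensional).continuousOn
  have hwv : φ w < φ v := (hw hx).trans_lt hxv
  refine ⟨w, ?_, hwv⟩
  suffices h : segment ℝ v w = F by rwa [h]
  refine ((hF.convex hP).segment_subset hvF hwF).antisymm fun y hy => ?_
  have hcoord : ∀ z ∈ F, ∃ t : ℝ, z = v + t • (w - v) := by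
    have hspan' : vectorSpan ℝ F = Submodule.span ℝ {w - v} := by
      refine (Submodule.eq_of_le_of_finrank_le ?_ ?_).symm
      · rw [Submodule.span_singleton_le_iff_mem]
        exact sub_mem_vectorSpan hwF hvF
      · rw [finrank_span_singleton (sub_ne_zero.2 fun h => hwv.ne (by rw [h]))]
        exact hdim.le
    intro z hz
    have h := sub_mem_vectorSpan hz hvF
    rw [hspan', Submodule.mem_span_singleton] at h
    obtain ⟨t, ht⟩ := h
    exact ⟨t, by rw [ht]; abel⟩
  obtain ⟨t, rfl⟩ := hcoord y hy
  -- The bound t ≤ 1 is the minimality of φ at w; t ≥ 0 holds because otherwise v would be interior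
  -- to a segment of P.
  have ht1 : t ≤ 1 := by
    have h : φ w ≤ φ (v + t • (w - v)) := hw hy
    simp only [map_add, map_smul, map_sub, smul_eq_mul] at h
    by_contra! h1
    nlinarith
  have ht0 : 0 ≤ t := by
    by_contra! h
    have hmem : v ∈ openSegment ℝ (v + t • (w - v)) w := by
      have h1t : 0 < 1 - t := by linarith
      refine ⟨1 / (1 - t), -t / (1 - t), by positivity, div_pos (by linarith) h1t, ?_, ?_⟩
      · field_simp
        ring
      · match_scalars <;> field_simp <;> ring
    have := hv.2 (hF.subset hy) (hF.subset hwF) hmem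
    have h2 : t • (w - v) = 0 := by simpa using this
    rcases smul_eq_zero.1 h2 with h3 | h3
    · exact h.ne h3
    · exact hwv.ne (by rw [sub_eq_zero.1 h3])
  rw [segment_eq_image']
  exact ⟨t, ⟨ht0, ht1⟩, rfl⟩

end Polytope

/-! ### Symmetries of the polytope, flags and reflections. -/

section Isometries

variable {E : Type*} [NormedAddCommGroup E] [NormedSpace ℝ E]
  {Λ : Submodule ℤ E} {P F : Set E} {g : E ≃ᵃ[ℝ] E}

theorem apply_mem_of_mem_isom (hg : g ∈ Isom Λ P) {x : E} (hx : x ∈ P) : g x ∈ P := by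
  have h := Set.mem_image_of_mem g hx
  rwa [hg.2] at h

theorem apply_mem_lattice (hg : g ∈ Isom Λ P) {x : E} (hx : x ∈ Λ) : g x ∈ Λ := by
  have h := Set.mem_image_of_mem g (SetLike.mem_coe.2 hx)
  rwa [hg.1] at h

theorem map_vsub_linear (g : E ≃ᵃ[ℝ] E) (x y : E) : g.linear (x - y) = g x - g y :=
  g.toAffineMap.linearMap_vsub x y

theorem IsFace.image [FiniteDimensional ℝ E] (hg : g ∈ Isom Λ P) (hF : IsFace P F) : IsFace P (g '' F) := by
  obtain ⟨φ, v, hv, hmin, hFeq⟩ := hF.exists_dual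
  have hg' : g.symm ∈ Isom Λ P := inv_mem hg
  have key : ∀ y, (φ ∘ₗ (g.symm.linear : E →ₗ[ℝ] E)) y - (φ ∘ₗ (g.symm.linear : E →ₗ[ℝ] E)) (g v)
      = φ (g.symm y) - φ v := by
    intro y
    have h : g.symm.linear (y - g v) = g.symm y - g.symm (g v) := map_vsub_linear g.symm y (g v)
    rw [g.symm_apply_apply] at h
    rw [← map_sub, ← map_sub, ← h]
    rfl
  convert isFace_of_forall_le (φ ∘ₗ (g.symm.linear : E →ₗ[ℝ] E)) (v := g v)
    (apply_mem_of_mem_isom hg (hF.subset hv)) (fun x hx => ?_)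
  · ext y
    rw [Set.mem_ofPred_eq, ← sub_eq_zero (b := (φ ∘ₗ (g.symm.linear : E →ₗ[ℝ] E)) (g v)), key,
      sub_eq_zero]
    constructor
    · rintro ⟨x, hx, rfl⟩
      rw [hFeq] at hx
      exact ⟨apply_mem_of_mem_isom hg hx.1, by rw [g.symm_apply_apply, hx.2]⟩
    · rintro ⟨hy, h⟩
      refine ⟨g.symm y, ?_, g.apply_symm_apply y⟩
      rw [hFeq]
      exact ⟨apply_mem_of_mem_isom hg' hy, h⟩
  · have := key x
    have := hmin _ (apply_mem_of_mem_isom hg' hx)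
    linarith

theorem apply_mem_vertices [FiniteDimensional ℝ E] (hP : ∃ S : Finset E, P = convexHull ℝ (S : Set E))
    (hg : g ∈ Isom Λ P) {v : E} (hv : v ∈ vertices P) : g v ∈ vertices P := by
  have h := (isFace_singleton hP hv).image hg
  rw [Set.image_singleton] at h
  exact mem_vertices_of_isFace_singleton h

theorem barycenter_eq_sum {s : Finset E} (hs : (s : Set E) = vertices F) :
    barycenter F = (s.card : ℝ)⁻¹ • ∑ v ∈ s, v := by
  rw [barycenter, ← hs, Set.ncard_coe_finset]
  congr 1
  exact finsum_mem_coe_finset _ _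

/-- An injective self-map of a finite set permutes it, and affine maps commute with averages. -/
theorem apply_barycenter {s : Finset E} (hs : (s : Set E) = vertices F) (hne : s.Nonempty)
    (hg : ∀ v ∈ vertices F, g v ∈ vertices F) : g (barycenter F) = barycenter F := by
  have hcard : (s.card : ℝ) ≠ 0 := by exact_mod_cast hne.card_ne_zero
  have hgx : ∀ x, g x = g.linear x + g 0 := fun x => by
    have := map_vsub_linear g x 0
    rw [sub_zero] at this
    rw [this, sub_add_cancel]
  have himg : ∑ v ∈ s, g v = ∑ v ∈ s, v := by
    classical
    have hsub : s.image g ⊆ s := by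
      intro w hw
      obtain ⟨v, hv, rfl⟩ := Finset.mem_image.1 hw
      exact_mod_cast hs ▸ hg v (hs ▸ hv)
    have heq : s.image g = s :=
      Finset.eq_of_subset_of_card_le hsub (Finset.card_image_of_injective s g.injective).ge
    conv_rhs => rw [← heq, Finset.sum_image g.injective.injOn]
  rw [barycenter_eq_sum hs, hgx, map_smul, map_sum]
  conv_rhs => rw [← himg, Finset.sum_congr rfl fun v _ => hgx v]
  rw [Finset.sum_add_distrib, Finset.sum_const, smul_add]
  rw [← Nat.cast_smul_eq_nsmul ℝ, smul_smul, inv_mul_cancel₀ hcard, one_smul]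

theorem barycenter_mem {s : Finset E} (hs : (s : Set E) = vertices F) (hne : s.Nonempty)
    (hF : Convex ℝ F) : barycenter F ∈ F := by
  have hcard : (s.card : ℝ) ≠ 0 := by exact_mod_cast hne.card_ne_zero
  rw [barycenter_eq_sum hs, Finset.smul_sum]
  refine hF.sum_mem (fun _ _ => by positivity) (by simp [hcard]) fun v hv => ?_
  have : v ∈ vertices F := hs ▸ hv
  exact this.1

theorem lt_apply_barycenter {s : Finset E} (hs : (s : Set E) = vertices F) (φ : Dual ℝ E) {c : ℝ}
    (hle : ∀ v ∈ vertices F, c ≤ φ v) (hlt : ∃ v ∈ vertices F, c < φ v) :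
    c < φ (barycenter F) := by
  obtain ⟨w, hw, hcw⟩ := hlt
  rw [← hs] at hw hle
  have hcard : (0 : ℝ) < s.card := by exact_mod_cast Finset.card_pos.2 ⟨w, hw⟩
  have h := Finset.sum_lt_sum (f := fun _ => c) (g := φ) hle ⟨w, hw, hcw⟩
  rw [Finset.sum_const, nsmul_eq_mul] at h
  rw [barycenter_eq_sum hs, map_smul, map_sum, smul_eq_mul, inv_mul_eq_div, lt_div_iff₀ hcard]
  linarith

theorem IsFace.exists_finset_vertices (hP : ∃ S : Finset E, P = convexHull ℝ (S : Set E))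
    (hF : IsFace P F) : ∃ s : Finset E, (s : Set E) = vertices F ∧ s.Nonempty := by
  have hfin : (vertices F).Finite := by
    rw [hF.vertices_eq]
    exact (finite_vertices hP).inter_of_right F
  obtain ⟨v, hvF, hv⟩ := hF.exists_vertex hP
  exact ⟨hfin.toFinset, hfin.coe_toFinset, v, by
    rw [hfin.mem_toFinset, hF.vertices_eq]; exact ⟨hvF, hv⟩⟩

/-- Every face is the start of a chain of faces whose dimensions increase by one, up to the
dimension of the space. -/
theorem IsFace.exists_chain [FiniteDimensional ℝ E] (hP : ∃ S : Finset E, P = convexHull ℝ (S : Set E))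
    (hspan : vectorSpan ℝ P = ⊤) (hF : IsFace P F) :
    ∃ G : ℕ → Set E, G (faceDim F) = F ∧
      (∀ i, faceDim F ≤ i → i ≤ finrank ℝ E → IsFace P (G i) ∧ faceDim (G i) = i) ∧
      ∀ i j, faceDim F ≤ i → i ≤ j → G i ⊆ G j := by
  obtain ⟨m, hm⟩ : ∃ m, finrank ℝ E - faceDim F = m := ⟨_, rfl⟩
  induction m generalizing F with
  | zero =>
    refine ⟨fun _ => F, rfl, fun i h1 h2 => ⟨hF, show faceDim F = i by omega⟩, fun _ _ _ _ => le_rfl⟩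
  | succ m ih =>
    have hne : ∃ x ∈ P, x ∉ F := by
      by_contra! h
      have hFP : F = P := hF.subset.antisymm h
      rw [hFP, faceDim, hspan, finrank_top] at hm
      omega
    obtain ⟨φ, v, hv, hmin, hFeq⟩ := hF.exists_dual
    obtain ⟨x, hx, hxF⟩ := hne
    have hxv : φ v < φ x := lt_of_le_of_ne (hmin x hx) fun h => hxF (by
      rw [hFeq]; exact ⟨hx, h.symm⟩)
    -- The opposite of the form supporting F decreases as soon as one leaves F.
    obtain ⟨F', hF', hFF', hdim, -⟩ := hF.exists_succ hP (-φ) (c := -φ v) (fun y hy => by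
      rw [hFeq] at hy; simp [hy.2]) ⟨x, hx, by simpa using hxv⟩
    obtain ⟨G, hG₀, hG₁, hG₂⟩ := ih hF' (by omega)
    refine ⟨fun i => if i = faceDim F then F else G i, by simp, fun i h1 h2 => ?_,
      fun i j h1 h2 => ?_⟩
    · by_cases h : i = faceDim F
      · simpa [h] using hF
      · simpa [h] using hG₁ i (by omega) h2
    · by_cases hj : j = faceDim F
      · have hi : i = faceDim F := by omega
        simp [hi, hj]
      · by_cases hi : i = faceDim F
        · simp only [hi, hj, if_true, if_false]
          refine hFF'.trans ?_
          have := hG₂ (faceDim F') j le_rfl (by omega)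
          rwa [hG₀] at this
        · simp only [hi, hj, if_false]
          exact hG₂ i j (by omega) h2

theorem vectorSpan_segment (a b : E) :
    vectorSpan ℝ (segment ℝ a b) = Submodule.span ℝ {b - a} := by
  rw [← convexHull_pair, vectorSpan_convexHull, vectorSpan_pair_rev]
  rfl

theorem faceDim_segment {a b : E} (h : a ≠ b) : faceDim (segment ℝ a b) = 1 := by
  rw [faceDim, vectorSpan_segment]
  exact finrank_span_singleton (sub_ne_zero.2 h.symm)

theorem vertices_segment_subset (a b : E) : vertices (segment ℝ a b) ⊆ {a, b} := by
  rw [← convexHull_pair]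
  exact extremePoints_convexHull_subset

/-- If a were not a vertex, the edge would be the hull of a subset of {b}, hence a = b, and a would
be a vertex after all. -/
theorem mem_vertices_left (hP : ∃ S : Finset E, P = convexHull ℝ (S : Set E)) {a b : E}
    (hab : IsFace P (segment ℝ a b)) : a ∈ vertices P := by
  by_contra ha
  have h := hab.convexHull_inter_vertices hP
  have hsub : segment ℝ a b ∩ vertices P ⊆ {b} := fun x hx => by
    rw [← hab.vertices_eq] at hx
    rcases vertices_segment_subset a b hx with rfl | h'
    · rw [hab.vertices_eq] at hx
      exact absurd hx.2 ha
    · exact h'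
  have hamem : a ∈ convexHull ℝ (segment ℝ a b ∩ vertices P) := by
    rw [h]
    exact left_mem_segment ℝ a b
  have hab' : a = b := convexHull_min hsub (convex_singleton b) hamem
  subst hab'
  rw [segment_same] at hab
  exact ha (mem_vertices_of_isFace_singleton hab)

theorem mem_vertices_right (hP : ∃ S : Finset E, P = convexHull ℝ (S : Set E)) {a b : E}
    (hab : IsFace P (segment ℝ a b)) : b ∈ vertices P :=
  mem_vertices_left hP (b := a) (segment_symm ℝ a b ▸ hab)

/-- If an affine bijection preserves `P` and all the faces of a chain of faces from dimension one
upwards, it fixes a hyperplane of directions complementary to the direction of the edge. -/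
theorem vectorSpan_le_fixed_sup [FiniteDimensional ℝ E] (hP : ∃ S : Finset E, P = convexHull ℝ (S : Set E))
    (hg : g ∈ Isom Λ P) {G : ℕ → Set E}
    (hG : ∀ i, 1 ≤ i → i ≤ finrank ℝ E → IsFace P (G i) ∧ faceDim (G i) = i)
    (hmono : ∀ i j, 1 ≤ i → i ≤ j → G i ⊆ G j)
    (hgG : ∀ i, 1 ≤ i → i ≤ finrank ℝ E → g '' G i = G i) {i : ℕ} (h1 : 1 ≤ i)
    (hi : i ≤ finrank ℝ E) :
    vectorSpan ℝ (G i) ≤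
      LinearMap.eqLocus (g.linear : E →ₗ[ℝ] E) LinearMap.id ⊔ vectorSpan ℝ (G 1) := by
  induction i, h1 using Nat.le_induction with
  | base => exact le_sup_right
  | succ i h1 ih =>
    have hi' : i ≤ finrank ℝ E := by omega
    obtain ⟨hF, hdim⟩ := hG i h1 hi'
    obtain ⟨hF', hdim'⟩ := hG (i + 1) (by omega) hi
    obtain ⟨s, hs, hsne⟩ := hF.exists_finset_vertices hP
    obtain ⟨s', hs', hsne'⟩ := hF'.exists_finset_vertices hP
    have hfix : ∀ j, 1 ≤ j → j ≤ finrank ℝ E → ∀ v ∈ vertices (G j), g v ∈ vertices (G j) := by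
      intro j hj1 hj v hv
      rw [(hG j hj1 hj).1.vertices_eq] at hv ⊢
      exact ⟨hgG j hj1 hj ▸ Set.mem_image_of_mem g hv.1, apply_mem_vertices hP hg hv.2⟩
    have hb := apply_barycenter hs hsne (hfix i h1 hi')
    have hb' := apply_barycenter hs' hsne' (hfix (i + 1) (by omega) hi)
    have hbm := barycenter_mem hs hsne (hF.convex hP)
    have hbm' := barycenter_mem hs' hsne' (hF'.convex hP)
    set b := barycenter (G i)
    set b' := barycenter (G (i + 1))
    obtain ⟨φ, v, hv, hmin, hFeq⟩ := hF.exists_dual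
    have hφF : ∀ x ∈ G i, φ x = φ v := fun x hx => by rw [hFeq] at hx; exact hx.2
    have hφV : vectorSpan ℝ (G i) ≤ LinearMap.ker φ := (vectorSpan_le_iff hv).2 fun x hx => by
      simp [hφF x hx]
    -- Some vertex of the larger face lies off the smaller one, so the supporting form is strictly
    -- larger at b'. Thus b' - b is a fixed vector transverse to the direction of the smaller face.
    have hlt : φ v < φ b' := by
      refine lt_apply_barycenter hs' φ (fun w hw => hmin w (hF'.subset hw.1)) ?_
      by_contra! H
      have hsub : G (i + 1) ⊆ G i := by
        rw [← hF'.convexHull_inter_vertices hP]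
        refine convexHull_min (fun w hw => ?_) (hF.convex hP)
        rw [hFeq]
        exact ⟨hF'.subset hw.1, le_antisymm (H w (hF'.vertices_eq ▸ hw)) (hmin w (hF'.subset hw.1))⟩
      have := Submodule.finrank_mono (vectorSpan_mono ℝ hsub)
      simp only [faceDim] at hdim hdim'
      omega
    have hnot : b' - b ∉ vectorSpan ℝ (G i) := fun h => by
      have := hφV h
      rw [LinearMap.mem_ker, map_sub, hφF b hbm] at this
      linarith
    have hle : vectorSpan ℝ (G i) ⊔ Submodule.span ℝ {b' - b} ≤ vectorSpan ℝ (G (i + 1)) := by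
      refine sup_le (vectorSpan_mono ℝ (hmono _ _ h1 (by omega))) ?_
      rw [Submodule.span_singleton_le_iff_mem]
      exact sub_mem_vectorSpan hbm' (hmono _ _ h1 (by omega) hbm)
    have heq := Submodule.eq_of_le_of_finrank_le hle (by
      rw [Submodule.finrank_sup_span_singleton hnot]
      simp only [faceDim] at hdim hdim'
      omega)
    rw [← heq]
    refine sup_le (ih hi') (le_sup_of_le_left ?_)
    rw [Submodule.span_singleton_le_iff_mem, LinearMap.mem_eqLocus]
    have h : g.linear (b' - b) = g b' - g b := map_vsub_linear g b' b
    rw [hb, hb'] at h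
    exact h

/-- For every edge of a centered regular lattice polytope, the group `Isom Λ P` contains a
linear reflection that exchanges the two ends of the edge. -/
theorem IsRegular.exists_reflection [FiniteDimensional ℝ E] (hreg : IsRegular Λ P) (hcent : IsCentered P) {s₁ s₂ : E}
    (hne : s₁ ≠ s₂) (hedge : IsFace P (segment ℝ s₁ s₂)) :
    ∃ g ∈ Isom Λ P, g s₁ = s₂ ∧ ∃ f : Dual ℝ E, f (s₂ - s₁) = 2 ∧
      ∀ x, g x = x - f x • (s₂ - s₁) := by
  obtain ⟨⟨⟨S, -, hS⟩, hspan⟩, htrans⟩ := hreg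
  have hP : ∃ S : Finset E, P = convexHull ℝ (S : Set E) := ⟨S, hS⟩
  have hspan' : vectorSpan ℝ P = ⊤ := by
    rw [← direction_affineSpan, hspan, AffineSubspace.direction_top]
  have h₁ := mem_vertices_left hP hedge
  have h₂ := mem_vertices_right hP hedge
  obtain ⟨G, hG₀, hG, hmono⟩ := hedge.exists_chain hP hspan'
  rw [faceDim_segment hne] at hG₀ hG hmono
  have hn : 1 ≤ finrank ℝ E := by
    rw [← faceDim_segment hne]
    exact Submodule.finrank_le _
  -- Two flags that differ only in dimension 0.
  let A : E → Fin (finrank ℝ E + 1) → Set E := fun s i => if (i : ℕ) = 0 then {s} else G i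
  have hflag : ∀ s ∈ vertices P, s ∈ segment ℝ s₁ s₂ → IsCompleteFlag P (A s) := by
    intro s hs hss
    refine ⟨fun i => ?_, fun i j hij => ?_⟩
    · by_cases h : (i : ℕ) = 0
      · simpa only [A, h, if_true] using ⟨isFace_singleton hP hs, faceDim_singleton s⟩
      · simpa only [A, h, if_false] using hG i (by omega) (by omega)
    · have hij' : (i : ℕ) ≤ j := hij
      by_cases hj : (j : ℕ) = 0
      · have hi : (i : ℕ) = 0 := by omega
        simp only [A, hi, hj, if_true, subset_refl]
      · by_cases hi : (i : ℕ) = 0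
        · simp only [A, hi, hj, if_true, if_false]
          refine Set.singleton_subset_iff.2 (hmono 1 j le_rfl (by omega) ?_)
          rwa [hG₀]
        · simp only [A, hi, hj, if_false]
          exact hmono i j (by omega) hij'
  obtain ⟨g, hg, hgA⟩ := htrans _ _ (hflag s₁ h₁ (left_mem_segment ℝ _ _))
    (hflag s₂ h₂ (right_mem_segment ℝ _ _))
  have hg₁ : g s₁ = s₂ := by simpa [A] using hgA 0
  have hgG : ∀ i, 1 ≤ i → i ≤ finrank ℝ E → g '' G i = G i := by
    intro i h1 hi
    have h0 : i ≠ 0 := by omega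
    have h := hgA ⟨i, by omega⟩
    simpa only [A, h0, if_false] using h
  have hg₂ : g s₂ = s₁ := by
    have hmem : g s₂ ∈ vertices (segment ℝ s₁ s₂) := by
      rw [hedge.vertices_eq]
      refine ⟨?_, apply_mem_vertices hP hg h₂⟩
      rw [← hG₀, ← hgG 1 le_rfl hn, hG₀]
      exact Set.mem_image_of_mem g (right_mem_segment ℝ _ _)
    rcases vertices_segment_subset _ _ hmem with h | h
    · exact h
    · exact absurd (g.injective (hg₁.trans (Set.mem_singleton_iff.1 h).symm)) hne
  have hg0 : g 0 = 0 := by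
    have hPface := isFace_self ⟨s₁, h₁.1⟩
    obtain ⟨s, hs, hsne⟩ := hPface.exists_finset_vertices hP
    have h := apply_barycenter hs hsne fun v hv => apply_mem_vertices hP hg hv
    rwa [show barycenter P = 0 from hcent] at h
  have hglin : ∀ x, g x = g.linear x := fun x => by
    have h : g.linear (x - 0) = g x - g 0 := map_vsub_linear g x 0
    rw [sub_zero, hg0, sub_zero] at h
    exact h.symm
  have htop : LinearMap.eqLocus (g.linear : E →ₗ[ℝ] E) LinearMap.id ⊔
      Submodule.span ℝ {s₂ - s₁} = ⊤ := by
    have h := vectorSpan_le_fixed_sup hP hg hG hmono hgG hn le_rfl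
    rw [hG₀, vectorSpan_segment] at h
    have hGn : vectorSpan ℝ (G (finrank ℝ E)) = ⊤ :=
      Submodule.eq_top_of_finrank_eq (hG _ hn le_rfl).2
    rwa [hGn, top_le_iff] at h
  have hneg : g (s₂ - s₁) = -(s₂ - s₁) := by
    have h : g.linear (s₂ - s₁) = g s₂ - g s₁ := map_vsub_linear g s₂ s₁
    rw [hglin, h, hg₁, hg₂, neg_sub]
  have hdec : ∀ x, ∃ c : ℝ, x - g.linear x = (2 * c) • (s₂ - s₁) := by
    intro x
    have hx : x ∈ LinearMap.eqLocus (g.linear : E →ₗ[ℝ] E) LinearMap.id ⊔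
      Submodule.span ℝ {s₂ - s₁} := htop ▸ Submodule.mem_top
    obtain ⟨y, hy, z, hz, rfl⟩ := Submodule.mem_sup.1 hx
    obtain ⟨c, rfl⟩ := Submodule.mem_span_singleton.1 hz
    have hy' : g.linear y = y := hy
    refine ⟨c, ?_⟩
    rw [map_add, hy', map_smul, ← hglin, hneg]
    module
  obtain ⟨l, hl⟩ : ∃ l : Dual ℝ E, l (s₂ - s₁) = 1 :=
    Projective.exists_dual_eq_one ℝ (sub_ne_zero.2 hne.symm)
  -- As x - g x is always a multiple of s₂ - s₁, the form l, equal to 1 on s₂ - s₁, reads off its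
  -- coefficient.
  refine ⟨g, hg, hg₁, l ∘ₗ ((LinearMap.id : E →ₗ[ℝ] E) - (g.linear : E →ₗ[ℝ] E)), ?_, fun x => ?_⟩
  · have h : ((LinearMap.id : E →ₗ[ℝ] E) - (g.linear : E →ₗ[ℝ] E)) (s₂ - s₁) = (2 : ℝ) • (s₂ - s₁) := by
      change (s₂ - s₁) - g.linear (s₂ - s₁) = _
      rw [← hglin, hneg]
      module
    rw [LinearMap.comp_apply, h, map_smul, hl, smul_eq_mul, mul_one]
  · obtain ⟨c, hc⟩ := hdec x
    have h : ((LinearMap.id : E →ₗ[ℝ] E) - (g.linear : E →ₗ[ℝ] E)) x = (2 * c) • (s₂ - s₁) := hc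
    rw [LinearMap.comp_apply, h, map_smul, hl, smul_eq_mul, mul_one, ← hc, ← hglin]
    abel

end Isometries

/-! ### The edge roots form a reduced root system. -/

section EdgeRoots

variable {E : Type*} [NormedAddCommGroup E] [NormedSpace ℝ E] {Λ : Submodule ℤ E} {P : Set E}

/-- A discrete subgroup meets a line through one of its non-zero elements in an infinite cyclic
group. -/
theorem exists_span_singleton_eq_inf [DiscreteTopology Λ] {d : E} (hd : d ≠ 0) :
    ∃ u : E, Submodule.span ℤ {u} = (Submodule.span ℝ {d}).restrictScalars ℤ ⊓ Λ := by
  let S : AddSubgroup ℝ :=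
    Λ.toAddSubgroup.comap (LinearMap.toSpanSingleton ℝ E d).toAddMonoidHom
  have hS : ∀ t, t ∈ S ↔ t • d ∈ Λ := fun t => Iff.rfl
  obtain ⟨ε, hε, hball⟩ := Metric.isOpen_singleton_iff.1 (isOpen_discrete ({0} : Set Λ))
  have hd' : 0 < ‖d‖ := norm_pos_iff.2 hd
  -- A subgroup of ℝ is dense or cyclic; a dense one would give arbitrarily short non-zero vectors
  -- of Λ.
  have hcyc : ∃ a, S = AddSubgroup.closure {a} := by
    rcases S.dense_or_cyclic with h | h
    · exfalso
      obtain ⟨t, ht, htS⟩ := h.exists_between (show (0 : ℝ) < ε / ‖d‖ by positivity)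
      have h1 := hball ⟨t • d, (hS t).1 ht⟩ (by
        rw [dist_zero_right, Submodule.coe_norm, norm_smul, Real.norm_of_nonneg htS.1.le]
        exact (lt_div_iff₀ hd').1 htS.2)
      have h2 : t • d = 0 := congrArg Subtype.val h1
      rcases smul_eq_zero.1 h2 with h3 | h3
      exacts [htS.1.ne' h3, hd h3]
    · exact h
  obtain ⟨a, ha⟩ := hcyc
  refine ⟨a • d, le_antisymm ?_ ?_⟩
  · rw [Submodule.span_singleton_le_iff_mem]
    refine ⟨Submodule.smul_mem _ _ (Submodule.mem_span_singleton_self d), (hS a).1 ?_⟩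
    rw [ha]
    exact AddSubgroup.mem_closure_singleton_self a
  · rintro x ⟨hx₁, hx₂⟩
    obtain ⟨t, rfl⟩ := Submodule.mem_span_singleton.1 hx₁
    have ht : t ∈ S := (hS t).2 hx₂
    rw [ha, AddSubgroup.mem_closure_singleton] at ht
    obtain ⟨n, rfl⟩ := ht
    refine Submodule.mem_span_singleton.2 ⟨n, ?_⟩
    rw [smul_assoc]

theorem IsLatticePolytope.exists_finset (h : IsLatticePolytope Λ P) :
    ∃ S : Finset E, P = convexHull ℝ (S : Set E) :=
  let ⟨⟨S, _, hS⟩, _⟩ := h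
  ⟨S, hS⟩

theorem IsLatticePolytope.vectorSpan_eq_top (h : IsLatticePolytope Λ P) : vectorSpan ℝ P = ⊤ := by
  rw [← direction_affineSpan, h.2, AffineSubspace.direction_top]

theorem IsLatticePolytope.nonempty (h : IsLatticePolytope Λ P) : P.Nonempty := by
  rw [← affineSpan_nonempty ℝ, h.2]
  exact ⟨0, trivial⟩

theorem IsLatticePolytope.vertices_subset (h : IsLatticePolytope Λ P) {v : E}
    (hv : v ∈ vertices P) : v ∈ Λ := by
  obtain ⟨⟨S, hSΛ, rfl⟩, -⟩ := h
  exact hSΛ (extremePoints_convexHull_subset hv)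

section Generator

variable {s₁ s₂ u : E} (hne : s₁ ≠ s₂) (h₁ : s₁ ∈ Λ) (h₂ : s₂ ∈ Λ)
  (hu : Submodule.span ℤ {u} = (Submodule.span ℝ {s₂ - s₁}).restrictScalars ℤ ⊓ Λ)

include hu

theorem generator_mem : u ∈ Λ :=
  (hu.le (Submodule.mem_span_singleton_self u)).2

include hne h₁ h₂

theorem exists_int_smul_generator : ∃ n : ℤ, n ≠ 0 ∧ s₂ - s₁ = (n : ℝ) • u := by
  have h : s₂ - s₁ ∈ Submodule.span ℤ {u} := by
    rw [hu]
    exact ⟨Submodule.mem_span_singleton_self _, sub_mem h₂ h₁⟩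
  obtain ⟨n, hn⟩ := Submodule.mem_span_singleton.1 h
  refine ⟨n, ?_, by rw [← hn, Int.cast_smul_eq_zsmul]⟩
  rintro rfl
  exact hne (sub_eq_zero.1 (by rw [← hn, zero_smul])).symm

theorem generator_ne_zero : u ≠ 0 := by
  rintro rfl
  obtain ⟨n, -, hn⟩ := exists_int_smul_generator hne h₁ h₂ hu
  rw [smul_zero, sub_eq_zero] at hn
  exact hne hn.symm

/-- Primitivity of u; both the integrality of the coroots and the reducedness come from it. -/
theorem exists_int_eq_of_smul_generator_mem {c : ℝ} (hc : c • u ∈ Λ) : ∃ n : ℤ, c = n := by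
  have hu₁ : u ∈ Submodule.span ℝ {s₂ - s₁} := (hu.le (Submodule.mem_span_singleton_self u)).1
  have h : c • u ∈ Submodule.span ℤ {u} := by
    rw [hu]
    exact ⟨Submodule.smul_mem _ c hu₁, hc⟩
  obtain ⟨n, hn⟩ := Submodule.mem_span_singleton.1 h
  rw [← Int.cast_smul_eq_zsmul ℝ] at hn
  exact ⟨n, (smul_left_injective ℝ (generator_ne_zero hne h₁ h₂ hu) hn).symm⟩

end Generator

theorem exists_edge_of_mem_edgeRoots [FiniteDimensional ℝ E] (hP : IsLatticePolytope Λ P) {u : E}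
    (h : u ∈ edgeRoots Λ P) : ∃ s₁ s₂ : E, s₁ ≠ s₂ ∧ s₁ ∈ Λ ∧ s₂ ∈ Λ ∧
      IsFace P (segment ℝ s₁ s₂) ∧
      Submodule.span ℤ {u} = (Submodule.span ℝ {s₂ - s₁}).restrictScalars ℤ ⊓ Λ := by
  obtain ⟨s₁, s₂, hne, hedge, hu⟩ := h
  exact ⟨s₁, s₂, hne, hP.vertices_subset (mem_vertices_left hP.exists_finset hedge),
    hP.vertices_subset (mem_vertices_right hP.exists_finset hedge), hedge, hu⟩

theorem finite_edgeRoots (hP : IsLatticePolytope Λ P) : (edgeRoots Λ P).Finite := by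
  have hfin := finite_vertices hP.exists_finset
  refine (hfin.biUnion fun s₁ _ => hfin.biUnion (t := fun s₂ => {u : E | Submodule.span ℤ {u} =
    (Submodule.span ℝ {s₂ - s₁}).restrictScalars ℤ ⊓ Λ}) fun s₂ _ => ?_).subset ?_
  · rcases Set.eq_empty_or_nonempty {u : E | Submodule.span ℤ {u} =
      (Submodule.span ℝ {s₂ - s₁}).restrictScalars ℤ ⊓ Λ} with h | ⟨u₀, hu₀⟩
    · rw [h]
      exact Set.finite_empty
    · refine (Set.toFinite {u₀, -u₀}).subset fun u hu => ?_
      have heq : Submodule.span ℤ {u₀} = Submodule.span ℤ {u} := Eq.trans hu₀ (Eq.symm hu)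
      have : IsAddTorsionFree E := .of_isTorsionFree ℝ E
      obtain ⟨z, rfl⟩ := Submodule.span_singleton_eq_span_singleton.1 heq
      rcases Int.units_eq_one_or z with rfl | rfl
      · simp
      · right
        simp [Units.smul_def]
  · rintro u ⟨s₁, s₂, -, hedge, hu⟩
    exact Set.mem_biUnion (mem_vertices_left hP.exists_finset hedge)
      (Set.mem_biUnion (mem_vertices_right hP.exists_finset hedge) hu)

/-- Every edge of a lattice polytope is an integral multiple of an edge root. -/
theorem exists_edgeRoot [DiscreteTopology Λ] (hP : IsLatticePolytope Λ P) {s₁ s₂ : E}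
    (hne : s₁ ≠ s₂) (hedge : IsFace P (segment ℝ s₁ s₂)) :
    ∃ u ∈ edgeRoots Λ P,
      Submodule.span ℤ {u} = (Submodule.span ℝ {s₂ - s₁}).restrictScalars ℤ ⊓ Λ ∧
      ∃ n : ℤ, n ≠ 0 ∧ s₂ - s₁ = (n : ℝ) • u := by
  obtain ⟨u, hu⟩ := exists_span_singleton_eq_inf (Λ := Λ) (sub_ne_zero.2 hne.symm)
  exact ⟨u, ⟨s₁, s₂, hne, hedge, hu⟩, hu, exists_int_smul_generator hne
    (hP.vertices_subset (mem_vertices_left hP.exists_finset hedge))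
    (hP.vertices_subset (mem_vertices_right hP.exists_finset hedge)) hu⟩

/-- A form vanishing on the roots decreases along no edge, and neither does its opposite; so it is
constant on P, which affinely spans E. -/
theorem span_edgeRoots [FiniteDimensional ℝ E] [DiscreteTopology Λ] (hP : IsLatticePolytope Λ P) :
    Submodule.span ℝ (edgeRoots Λ P) = ⊤ := by
  by_contra hlt
  obtain ⟨φ, hφ, hker⟩ := Submodule.exists_le_ker_of_lt_top _ (lt_top_iff_ne_top.2 hlt)
  obtain ⟨v, -, hv⟩ := (isFace_self hP.nonempty).exists_vertex hP.exists_finset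
  have key : ∀ ψ : Dual ℝ E, (∀ u ∈ edgeRoots Λ P, ψ u = 0) → ∀ x ∈ P, ψ v ≤ ψ x := by
    intro ψ hψ x hx
    by_contra! h
    obtain ⟨w, hw, hlt⟩ := exists_edge_lt hP.exists_finset hv ψ ⟨x, hx, h⟩
    have hne : v ≠ w := by
      rintro rfl
      exact lt_irrefl _ hlt
    obtain ⟨u, hu, -, n, -, hn⟩ := exists_edgeRoot hP hne hw
    have := congrArg ψ hn
    rw [map_sub, map_smul, hψ u hu, smul_zero] at this
    linarith
  have hzero : ∀ u ∈ edgeRoots Λ P, φ u = 0 := fun u hu => hker (Submodule.subset_span hu)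
  have hspan : vectorSpan ℝ P ≤ LinearMap.ker φ := (vectorSpan_le_iff hv.1).2 fun x hx => by
    have h1 := key φ hzero x hx
    have h2 := key (-φ) (fun u hu => by simp [hzero u hu]) x hx
    simp only [LinearMap.neg_apply, neg_le_neg_iff] at h2
    rw [LinearMap.mem_ker, map_sub, le_antisymm h2 h1, sub_self]
  rw [hP.vectorSpan_eq_top, top_le_iff, LinearMap.ker_eq_top] at hspan
  exact hφ hspan

theorem linear_mem_edgeRoots [FiniteDimensional ℝ E] {g : E ≃ᵃ[ℝ] E} (hg : g ∈ Isom Λ P)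
    (hlin : ∀ x, g x = g.linear x) {u : E} (hu : u ∈ edgeRoots Λ P) : g u ∈ edgeRoots Λ P := by
  obtain ⟨s₁, s₂, hne, hedge, hu⟩ := hu
  refine ⟨g s₁, g s₂, g.injective.ne hne, ?_, ?_⟩
  · have h := image_segment ℝ (g : E →ᵃ[ℝ] E) s₁ s₂
    have h' := hedge.image hg
    simp only [AffineEquiv.coe_toAffineMap] at h
    rwa [h] at h'
  · let L : E →ₗ[ℝ] E := g.linear
    let Lz : E →ₗ[ℤ] E := L.restrictScalars ℤ
    have hL : ∀ x, Lz x = g x := fun x => (hlin x).symm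
    have hinj : Function.Injective Lz := fun x y h => g.injective (by rw [← hL, ← hL, h])
    have hΛ : Λ.map Lz = Λ := by
      apply SetLike.coe_injective
      rw [Submodule.map_coe, ← hg.1]
      simp only [hL, hg.1]
    have hline : ((Submodule.span ℝ {s₂ - s₁}).restrictScalars ℤ).map Lz =
        (Submodule.span ℝ {g s₂ - g s₁}).restrictScalars ℤ := by
      have h : L (s₂ - s₁) = g s₂ - g s₁ := map_vsub_linear g s₂ s₁
      rw [← h, ← Set.image_singleton (f := L), ← Submodule.map_span]
      rfl
    rw [← hL u, ← Set.image_singleton, ← Submodule.map_span, hu, Submodule.map_inf _ hinj, hΛ, hline]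

/-- The reflection attached to an edge root. -/
theorem IsRegular.exists_coroot [FiniteDimensional ℝ E] (hreg : IsRegular Λ P)
    (hcent : IsCentered P) {s₁ s₂ u : E} (hne : s₁ ≠ s₂) (hedge : IsFace P (segment ℝ s₁ s₂))
    (hu : Submodule.span ℤ {u} = (Submodule.span ℝ {s₂ - s₁}).restrictScalars ℤ ⊓ Λ) :
    ∃ f : Dual ℝ E, f u = 2 ∧ Set.MapsTo (preReflection u f) (edgeRoots Λ P) (edgeRoots Λ P) ∧
      (∀ x ∈ Λ, ∃ n : ℤ, f x = n) ∧
      (∀ v ∈ vertices P, preReflection u f v ∈ vertices P) ∧ preReflection u f s₁ = s₂ := by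
  have hP := hreg.1
  have h₁ := hP.vertices_subset (mem_vertices_left hP.exists_finset hedge)
  have h₂ := hP.vertices_subset (mem_vertices_right hP.exists_finset hedge)
  obtain ⟨g, hg, hg₁, f, hf, hgf⟩ := hreg.exists_reflection hcent hne hedge
  obtain ⟨n, hn, hnu⟩ := exists_int_smul_generator hne h₁ h₂ hu
  have hgx : ∀ x, preReflection u ((n : ℝ) • f) x = g x := fun x => by
    rw [hgf, hnu, preReflection_apply, LinearMap.smul_apply, smul_smul, smul_eq_mul, mul_comm]
  have hlin : ∀ x, g x = g.linear x := fun x => by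
    have h := map_vsub_linear g x 0
    rwa [sub_zero, ← hgx 0, map_zero, sub_zero, eq_comm] at h
  -- Since s₂ - s₁ = n u, replacing s₂ - s₁ by u multiplies the form by n.
  refine ⟨(n : ℝ) • f, ?_, fun w hw => ?_, fun x hx => ?_, fun v hv => ?_, ?_⟩
  · rw [LinearMap.smul_apply, ← map_smul, ← hnu, hf]
  · rw [hgx]
    exact linear_mem_edgeRoots hg hlin hw
  · apply exists_int_eq_of_smul_generator_mem hne h₁ h₂ hu
    have h : ((n : ℝ) • f) x • u = x - g x := by
      rw [← hgx, preReflection_apply, sub_sub_cancel]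
    rw [h]
    exact sub_mem hx (apply_mem_lattice hg hx)
  · rw [hgx]
    exact apply_mem_vertices hP.exists_finset hg hv
  · rw [hgx, hg₁]

/-- Two roots of a finite set of vectors with the same coroot coincide. -/
theorem eq_of_preReflection_mapsTo_of_coroot_eq {Φ : Set E} (hΦ : Φ.Finite) {α β : E}
    {f : Dual ℝ E} (hα : α ∈ Φ) (hfα : f α = 2) (hfβ : f β = 2)
    (hmα : Set.MapsTo (preReflection α f) Φ Φ) (hmβ : Set.MapsTo (preReflection β f) Φ Φ) :
    α = β := by
  by_contra hne
  -- On vectors where f is 2, the product of the two reflections is translation by 2(α - β), so α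
  -- has an infinite orbit if α ≠ β.
  have hstep : ∀ k : ℕ, α + (2 * k : ℝ) • (α - β) ∈ Φ := by
    intro k
    induction k with
    | zero => simpa using hα
    | succ k ih =>
      have h := hmα (hmβ ih)
      have hf : f (α + (2 * k : ℝ) • (α - β)) = 2 := by simp [hfα, hfβ]
      have heq : preReflection α f (preReflection β f (α + (2 * k : ℝ) • (α - β))) =
          α + (2 * (k + 1 : ℕ) : ℝ) • (α - β) := by
        rw [preReflection_apply, preReflection_apply, map_sub, map_smul, hf, hfβ]
        push_cast
        module
      rwa [heq] at h
  refine Set.infinite_of_injective_forall_mem (fun k l hkl => ?_) hstep hΦ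
  have h := smul_left_injective ℝ (sub_ne_zero.2 hne) (add_left_cancel hkl)
  exact_mod_cast mul_left_cancel₀ two_ne_zero h

/-- The edge roots of a centered regular lattice polytope form a reduced root system. -/
theorem IsRegular.exists_rootPairing [FiniteDimensional ℝ E] [DiscreteTopology Λ]
    (hreg : IsRegular Λ P) (hcent : IsCentered P) :
    ∃ R : RootPairing (edgeRoots Λ P) ℝ E (Dual ℝ E),
      IsReducedRootSystemOn (edgeRoots Λ P) R := by
  have hP := hreg.1
  have hfin := finite_edgeRoots hP
  have : Finite (edgeRoots Λ P) := hfin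
  have hex : ∀ α : edgeRoots Λ P, ∃ f : Dual ℝ E, f α = 2 ∧
      Set.MapsTo (preReflection (α : E) f) (edgeRoots Λ P) (edgeRoots Λ P) ∧
      ∀ x ∈ Λ, ∃ n : ℤ, f x = n := fun α => by
    obtain ⟨s₁, s₂, hne, hedge, hu⟩ := α.2
    obtain ⟨f, hf₁, hf₂, hf₃, -⟩ := hreg.exists_coroot hcent hne hedge hu
    exact ⟨f, hf₁, hf₂, hf₃⟩
  choose f hf₁ hf₂ hf₃ using hex
  have hinj : Function.Injective f := fun α β h => Subtype.ext <|
    eq_of_preReflection_mapsTo_of_coroot_eq hfin α.2 (hf₁ α) (h ▸ hf₁ β) (hf₂ α) (h ▸ hf₂ β)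
  let root : edgeRoots Λ P ↪ E := Function.Embedding.subtype _
  have hrange : Set.range root = edgeRoots Λ P := Subtype.range_coe
  have hspan : Submodule.span ℝ (Set.range root) = ⊤ := by rw [hrange, span_edgeRoots hP]
  have hint : ∀ i j : edgeRoots Λ P, ∃ z : ℤ, (z : ℝ) = Dual.eval ℝ E (root i) (f j) := by
    intro i j
    obtain ⟨s₁, s₂, -, -, hu⟩ := i.2
    obtain ⟨n, hn⟩ := hf₃ j i (generator_mem hu)
    exact ⟨n, hn.symm⟩
  let R : RootPairing (edgeRoots Λ P) ℝ E (Dual ℝ E) :=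
    RootPairing.mk'' (Dual.eval ℝ E) root ⟨f, hinj⟩ hf₁
      (fun i => by rw [hrange]; exact hf₂ i) hspan
  refine ⟨R, hfin, fun _ => rfl, RootPairing.isRootSystem_mk'' hint, ⟨hint⟩, ⟨fun i j hij => ?_⟩⟩
  obtain ⟨s₁, s₂, hs, hs₁, hs₂, -, hi⟩ := exists_edge_of_mem_edgeRoots hP i.2
  obtain ⟨t₁, t₂, ht, ht₁, ht₂, -, hj⟩ := exists_edge_of_mem_edgeRoots hP j.2
  change (i : E) = j ∨ (i : E) = -j
  change ¬LinearIndependent ℝ ![(i : E), (j : E)] at hij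
  have hi0 := generator_ne_zero hs hs₁ hs₂ hi
  rw [LinearIndependent.pair_iff' hi0] at hij
  push Not at hij
  obtain ⟨a, ha⟩ := hij
  have hj0 := generator_ne_zero ht ht₁ ht₂ hj
  have ha0 : a ≠ 0 := by
    rintro rfl
    exact hj0 (by rw [← ha, zero_smul])
  -- Both roots are primitive, so a and its inverse are integers.
  obtain ⟨m, hm⟩ := exists_int_eq_of_smul_generator_mem hs hs₁ hs₂ hi (c := a)
    (ha ▸ generator_mem hj)
  have ha' : a⁻¹ • (j : E) = i := by rw [← ha, smul_smul, inv_mul_cancel₀ ha0, one_smul]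
  obtain ⟨n, hn⟩ := exists_int_eq_of_smul_generator_mem ht ht₁ ht₂ hj (c := a⁻¹)
    (ha' ▸ generator_mem hi)
  have hmn : n * m = 1 := by
    have h : (n : ℝ) * m = 1 := by rw [← hn, ← hm, inv_mul_cancel₀ ha0]
    exact_mod_cast h
  rcases Int.eq_one_or_neg_one_of_mul_eq_one hmn with rfl | rfl
  · left
    rw [← ha', hn, Int.cast_one, one_smul]
  · right
    rw [← ha', hn, Int.cast_neg, Int.cast_one, neg_one_smul]

end EdgeRoots

/-! ### The Weyl group acting on the vertices. -/

section WeylGroup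

variable {E : Type*} [NormedAddCommGroup E] [NormedSpace ℝ E]
  {Λ : Submodule ℤ E} {P : Set E}

theorem IsReducedRootSystemOn.range_root {Φ : Set E} {R : RootPairing Φ ℝ E (Dual ℝ E)}
    (hR : IsReducedRootSystemOn Φ R) : Set.range R.root = Φ := by
  ext x
  constructor
  · rintro ⟨α, rfl⟩
    rw [hR.root_eq]
    exact α.2
  · exact fun hx => ⟨⟨x, hx⟩, hR.root_eq _⟩

/-- In a finite spanning set a root determines its coroot, so every presentation R has the geometric
reflections. -/
theorem IsReducedRootSystemOn.reflection_eq [FiniteDimensional ℝ E]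
    {Φ : Set E} {R : RootPairing Φ ℝ E (Dual ℝ E)}
    (hR : IsReducedRootSystemOn Φ R) (α : Φ) {f : Dual ℝ E} (hf : f α = 2)
    (hfΦ : Set.MapsTo (preReflection (α : E) f) Φ Φ) (x : E) :
    R.reflection α x = preReflection (α : E) f x := by
  have hspan : Submodule.span ℝ Φ = ⊤ := by
    have := hR.isRootSystem.span_root_eq_top
    rwa [hR.range_root] at this
  have hroot : R.root α = (α : E) := hR.root_eq α
  have heq : R.coroot' α = f := by
    refine Dual.eq_of_preReflection_mapsTo (x := (α : E)) hR.finite hspan ?_ ?_ hf hfΦ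
    · rw [← hroot]
      exact R.coroot_root_two α
    · have h := R.mapsTo_reflection_root α
      rw [hR.range_root] at h
      rw [← hroot]
      exact h
  rw [R.reflection_apply, heq, hroot, preReflection_apply]

theorem IsRegular.weylGroup_smul_mem_vertices [FiniteDimensional ℝ E]
    (hreg : IsRegular Λ P) (hcent : IsCentered P)
    {R : RootPairing (edgeRoots Λ P) ℝ E (Dual ℝ E)} (hR : IsReducedRootSystemOn (edgeRoots Λ P) R)
    (g : R.weylGroup) {v : E} (hv : v ∈ vertices P) : g • v ∈ vertices P := by
  obtain ⟨g, hg⟩ := g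
  change g • v ∈ vertices P
  induction hg using RootPairing.weylGroup.induction generalizing v with
  | mem α =>
    obtain ⟨s₁, s₂, hne, hedge, hu⟩ := α.2
    obtain ⟨f, hf, hfΦ, -, hfv, -⟩ := hreg.exists_coroot hcent hne hedge hu
    rw [RootPairing.Equiv.reflection_smul, hR.reflection_eq α hf hfΦ]
    exact hfv v hv
  | one => rwa [one_smul]
  | mul x y hx hy ihx ihy =>
    rw [mul_smul]
    exact ihx (ihy hv)

/-- Let φ have its unique minimum at w. A φ-minimal vertex m outside the orbit of w would have an
edge going down to some x; x is in the orbit, and the reflection of that edge sends m to x. -/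
theorem IsRegular.exists_weylGroup_smul_eq [FiniteDimensional ℝ E]
    [DiscreteTopology Λ] (hreg : IsRegular Λ P)
    (hcent : IsCentered P) {R : RootPairing (edgeRoots Λ P) ℝ E (Dual ℝ E)}
    (hR : IsReducedRootSystemOn (edgeRoots Λ P) R) {v w : E} (hv : v ∈ vertices P)
    (hw : w ∈ vertices P) : ∃ g : R.weylGroup, g • v = w := by
  have hP := hreg.1.exists_finset
  obtain ⟨φ, hφ⟩ := exists_dual_lt hP hw
  by_contra hvw
  have hfin : {v ∈ vertices P | ¬∃ g : R.weylGroup, g • v = w}.Finite :=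
    (finite_vertices hP).subset (Set.sep_subset _ _)
  obtain ⟨m, ⟨hm, hmw⟩, hmin⟩ := hfin.exists_minimalFor φ _ ⟨v, hv, hvw⟩
  have hne : m ≠ w := by
    rintro rfl
    exact hmw ⟨1, one_smul _ _⟩
  obtain ⟨x, hx, hlt⟩ := exists_edge_lt hP hm φ ⟨w, hw.1, hφ m hm.1 hne⟩
  have hmx : m ≠ x := by
    rintro rfl
    exact lt_irrefl _ hlt
  obtain ⟨u, huΦ, hu, -⟩ := exists_edgeRoot hreg.1 hmx hx
  obtain ⟨f, hf, hfΦ, -, -, hfm⟩ := hreg.exists_coroot hcent hmx hx hu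
  have hgx : ∃ g : R.weylGroup, g • x = w := by
    by_contra h
    exact absurd (hmin ⟨mem_vertices_right hP hx, h⟩ hlt.le) (not_le.2 hlt)
  obtain ⟨g, hg⟩ := hgx
  refine hmw ⟨g * RootPairing.weylGroup.ofIdx R ⟨u, huΦ⟩, ?_⟩
  rw [mul_smul, RootPairing.weylGroup.ofIdx_smul, RootPairing.Equiv.reflection_smul,
    hR.reflection_eq ⟨u, huΦ⟩ hf hfΦ, hfm, hg]

end WeylGroup

/-! ### Dual cones as unions of Weyl chambers. -/

section DualFan

variable {E : Type*} [NormedAddCommGroup E] [NormedSpace ℝ E]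
  {Λ : Submodule ℤ E} {P : Set E}

theorem isClosed_dualCone (P F : Set E) : IsClosed (dualCone P F) := by
  have h : dualCone P F = ⋂ v ∈ F, ⋂ x ∈ P, {φ : StrongDual ℝ E | φ v ≤ φ x} := by
    ext φ
    simp [dualCone]
  rw [h]
  refine isClosed_biInter fun v _ => isClosed_biInter fun x _ => isClosed_le ?_ ?_ <;> fun_prop

theorem eventually_add_mul_ne_zero {a b : ℝ} (hb : b ≠ 0) :
    ∀ᶠ t : ℝ in nhdsWithin 0 (Set.Ioi 0), a + t * b ≠ 0 := by
  by_cases ha : a = 0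
  · filter_upwards [self_mem_nhdsWithin] with t ht
    rw [ha, zero_add]
    exact mul_ne_zero (Set.mem_Ioi.1 ht).ne' hb
  · have h : Tendsto (fun t : ℝ => a + t * b) (nhds 0) (nhds a) :=
      Continuous.tendsto' (by fun_prop) _ _ (by simp)
    exact (h.eventually_ne ha).filter_mono nhdsWithin_le_nhds

/-- A vertex of `P` is the unique minimum of a form not vanishing on given non-zero vectors. -/
theorem exists_regularForms_lt [FiniteDimensional ℝ E]
    (hP : ∃ S : Finset E, P = convexHull ℝ (S : Set E)) {Φ : Set E} (hΦ : Φ.Finite)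
    (h0 : ∀ α ∈ Φ, α ≠ 0) {v : E} (hv : v ∈ vertices P) :
    ∃ ψ ∈ regularForms Φ, ∀ x ∈ vertices P, x ≠ v → ψ v < ψ x := by
  obtain ⟨φ, hφ⟩ := exists_dual_lt hP hv
  have : Finite Φ := hΦ
  obtain ⟨θ, hθ⟩ := Module.exists_dual_forall_apply_ne_zero (K := ℝ) (fun α : Φ => (α : E))
    fun α => h0 α α.2
  have h₁ : ∀ᶠ t : ℝ in nhdsWithin 0 (Set.Ioi 0), ∀ α ∈ Φ, φ α + t * θ α ≠ 0 :=
    (Filter.eventually_all_finite hΦ).2 fun α hα => eventually_add_mul_ne_zero (hθ ⟨α, hα⟩)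
  have h₂ : ∀ᶠ t : ℝ in nhdsWithin 0 (Set.Ioi 0), ∀ x ∈ vertices P, x ≠ v →
      φ v + t * θ v < φ x + t * θ x := by
    refine (Filter.eventually_all_finite (finite_vertices hP)).2 fun x hx => ?_
    by_cases hxv : x = v
    · simp [hxv]
    · have hl : Tendsto (fun t : ℝ => φ v + t * θ v) (nhds 0) (nhds (φ v)) :=
        Continuous.tendsto' (by fun_prop) _ _ (by simp)
      have hr : Tendsto (fun t : ℝ => φ x + t * θ x) (nhds 0) (nhds (φ x)) :=
        Continuous.tendsto' (by fun_prop) _ _ (by simp)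
      filter_upwards [(hl.eventually_lt hr (hφ x hx.1 hxv)).filter_mono nhdsWithin_le_nhds]
        with t ht _ using ht
  obtain ⟨t, ht₁, ht₂⟩ := (h₁.and h₂).exists
  exact ⟨LinearMap.toContinuousLinearMap (φ + t • θ), fun α hα => by simpa using ht₁ α hα,
    fun x hx hxv => by simpa using ht₂ x hx hxv⟩

theorem IsLatticePolytope.ne_zero_of_mem_edgeRoots [FiniteDimensional ℝ E]
    (hP : IsLatticePolytope Λ P) {u : E} (hu : u ∈ edgeRoots Λ P) : u ≠ 0 := by
  obtain ⟨s₁, s₂, hs, hs₁, hs₂, -, hi⟩ := exists_edge_of_mem_edgeRoots hP hu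
  exact generator_ne_zero hs hs₁ hs₂ hi

/-- The dual cone of a vertex contains every Weyl chamber that it meets in a form whose unique
minimum is this vertex. -/
theorem IsLatticePolytope.connectedComponentIn_subset_dualCone [FiniteDimensional ℝ E]
    [DiscreteTopology Λ] (hP : IsLatticePolytope Λ P) {v : E} (hv : v ∈ vertices P)
    {φ : StrongDual ℝ E} (hφ : φ ∈ regularForms (edgeRoots Λ P))
    (hlt : ∀ x ∈ vertices P, x ≠ v → φ v < φ x) :
    connectedComponentIn (regularForms (edgeRoots Λ P)) φ ⊆ dualCone P {v} := by
  intro χ hχ y hy x hx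
  rw [Set.mem_singleton_iff] at hy
  subst y
  by_contra! h
  obtain ⟨w, hw, hwv⟩ := exists_edge_lt hP.exists_finset hv (χ : E →ₗ[ℝ] ℝ) ⟨x, hx, h⟩
  have hne : w ≠ v := fun h' => hwv.ne (by rw [h'])
  obtain ⟨u, hu, -, n, hn, hnu⟩ := exists_edgeRoot hP hne.symm hw
  have hpos := hlt w (mem_vertices_right hP.exists_finset hw) hne
  -- Evaluation at w - v is negative at χ and positive at φ, so it vanishes somewhere on the
  -- chamber; but w - v is a non-zero multiple of a root.
  have hcont : Continuous fun ξ : StrongDual ℝ E => ξ (w - v) :=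
    (ContinuousLinearMap.apply ℝ ℝ (w - v)).continuous
  obtain ⟨ξ, hξ, hξ0⟩ := isPreconnected_connectedComponentIn.intermediate_value hχ
    (mem_connectedComponentIn hφ) hcont.continuousOn
    (show (0 : ℝ) ∈ Set.Icc _ _ from ⟨by
      rw [map_sub]; exact sub_nonpos.2 hwv.le, by rw [map_sub]; exact (sub_pos.2 hpos).le⟩)
  have hreg := connectedComponentIn_subset _ _ hξ u hu
  simp only at hξ0
  rw [hnu, map_smul, smul_eq_mul] at hξ0
  rcases mul_eq_zero.1 hξ0 with h' | h'
  · exact hn (by exact_mod_cast h')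
  · exact hreg h'

/-- The dual cone of a vertex is a union of closed Weyl chambers. -/
theorem IsLatticePolytope.dualCone_eq_iUnion [FiniteDimensional ℝ E]
    [DiscreteTopology Λ] (hP : IsLatticePolytope Λ P) {v : E} (hv : v ∈ vertices P) :
    dualCone P {v} =
      ⋃ C ∈ {C ∈ weylChambers (edgeRoots Λ P) | C ⊆ dualCone P {v}}, closure C := by
  refine Set.Subset.antisymm (fun φ hφ => ?_)
    (Set.iUnion₂_subset fun C hC => (isClosed_dualCone P {v}).closure_subset_iff.2 hC.2)
  obtain ⟨ψ, hψ, hlt⟩ := exists_regularForms_lt hP.exists_finset (finite_edgeRoots hP)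
    (fun _ => hP.ne_zero_of_mem_edgeRoots) hv
  -- The form φ may lie on walls. Moving it slightly towards ψ leaves them all, and the open
  -- interval of small t, being connected, stays in one chamber C with φ in its closure.
  have hev : ∀ᶠ t : ℝ in nhdsWithin 0 (Set.Ioi 0), φ + t • ψ ∈ regularForms (edgeRoots Λ P) :=
    (Filter.eventually_all_finite (finite_edgeRoots hP)).2 fun α hα => by
      simpa using eventually_add_mul_ne_zero (a := φ α) (hψ α hα)
  obtain ⟨ε, hε, hεr⟩ := mem_nhdsGT_iff_exists_Ioo_subset.1 hev
  have hε : 0 < ε := hε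
  have hcont : Continuous fun t : ℝ => φ + t • ψ := by fun_prop
  have hmid : ε / 2 ∈ Set.Ioo 0 ε := ⟨by positivity, by linarith⟩
  set C := connectedComponentIn (regularForms (edgeRoots Λ P)) (φ + (ε / 2) • ψ)
  have hsub : (fun t : ℝ => φ + t • ψ) '' Set.Ioo 0 ε ⊆ C :=
    (isPreconnected_Ioo.image _ hcont.continuousOn).subset_connectedComponentIn
      ⟨_, hmid, rfl⟩ (Set.image_subset_iff.2 hεr)
  refine Set.mem_biUnion (x := C) ⟨⟨_, hεr hmid, rfl⟩, ?_⟩ ?_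
  · refine hP.connectedComponentIn_subset_dualCone hv (hεr hmid) fun x hx hxv => ?_
    have h1 := hφ v rfl x hx.1
    have h2 := mul_lt_mul_of_pos_left (hlt x hx hxv) hmid.1
    simp only [add_apply, smul_apply, smul_eq_mul]
    linarith
  · have ht : Tendsto (fun t : ℝ => φ + t • ψ) (nhdsWithin 0 (Set.Ioi 0)) (nhds φ) :=
      (hcont.tendsto' 0 φ (by simp)).mono_left nhdsWithin_le_nhds
    refine mem_closure_of_tendsto ht ?_
    filter_upwards [Ioo_mem_nhdsGT hε] with t ht using hsub ⟨t, ht, rfl⟩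

/-- The maximal cones of the dual fan are dual cones of vertices. -/
theorem exists_vertex_of_maximal_dualFan [FiniteDimensional ℝ E]
    (hP : ∃ S : Finset E, P = convexHull ℝ (S : Set E)) {σ : Set (StrongDual ℝ E)}
    (hσ : Maximal (· ∈ dualFan P) σ) : ∃ v ∈ vertices P, σ = dualCone P {v} := by
  obtain ⟨F, hF, rfl⟩ := hσ.prop
  obtain ⟨v, hvF, hv⟩ := hF.exists_vertex hP
  have hle : dualCone P F ⊆ dualCone P {v} := by
    rintro φ hφ _ rfl
    exact hφ _ hvF
  exact ⟨v, hv, hσ.eq_of_le ⟨{v}, isFace_singleton hP hv, rfl⟩ hle⟩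

end DualFan

end LatticePolytope

theorem mainTheorem4 {E : Type*} [NormedAddCommGroup E] [NormedSpace ℝ E]
    [FiniteDimensional ℝ E] (Λ : Submodule ℤ E) [DiscreteTopology Λ] [IsZLattice ℝ Λ]
    (P : Set E) (hreg : LatticePolytope.IsRegular Λ P) (hcent : LatticePolytope.IsCentered P) :
    (∃ R : RootPairing (LatticePolytope.edgeRoots Λ P) ℝ E (Module.Dual ℝ E),
      LatticePolytope.IsReducedRootSystemOn (LatticePolytope.edgeRoots Λ P) R) ∧
    (∀ R : RootPairing (LatticePolytope.edgeRoots Λ P) ℝ E (Module.Dual ℝ E),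
      LatticePolytope.IsReducedRootSystemOn (LatticePolytope.edgeRoots Λ P) R →
        (∀ g : R.weylGroup, ∀ v ∈ LatticePolytope.vertices P,
          g • v ∈ LatticePolytope.vertices P) ∧
        (∀ v ∈ LatticePolytope.vertices P, ∀ w ∈ LatticePolytope.vertices P,
          ∃ g : R.weylGroup, g • v = w)) ∧
    (∀ σ, Maximal (· ∈ LatticePolytope.dualFan P) σ →
      ∃ 𝒞 ⊆ LatticePolytope.weylChambers (LatticePolytope.edgeRoots Λ P),
        σ = ⋃ C ∈ 𝒞, closure C) := by
  refine ⟨hreg.exists_rootPairing hcent, fun R hR => ⟨fun g v hv =>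
    hreg.weylGroup_smul_mem_vertices hcent hR g hv, fun v hv w hw =>
    hreg.exists_weylGroup_smul_eq hcent hR hv hw⟩, fun σ hσ => ?_⟩
  obtain ⟨v, hv, rfl⟩ := LatticePolytope.exists_vertex_of_maximal_dualFan hreg.1.exists_finset hσ
  exact ⟨_, Set.sep_subset _ _, hreg.1.dualCone_eq_iUnion hv⟩
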